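/- **Theorem.** Let $n,m\ge 0$ be integers and let $\mathcal G_{n,m}$ be the space of pairs $(G,H)$, where $G$ is an undirected, unweighted (simple) graph on the vertices $v_1,\dots,v_n$ and $H=(h_1,\dots,h_n)\in(\mathbb R^m)^n$ assigns a feature to each vertex; it carries the product of the discrete topology (on graphs) and the Euclidean topology (on features). A permutation $\sigma\in S_n$ acts on $\mathcal G_{n,m}$ by relabelling the vertices and on $\mathbb R^n$ by permuting the coordinates. A function $\Phi:\mathcal G_{n,m}\to\mathbb R$ is *permutation-invariant* if $\Phi(\sigma*(G,H))=\Phi(G,H)$ for all $\sigma\in S_n$ and all $(G,H)$, and $\Phi_v:\mathcal G_{n,m}\to\mathbb R^n$ is *permutation-equivariant* if $\Phi_v(\sigma*(G,H))=\sigma(\Phi_v(G,H))$ for all $\sigma\in S_n$ and all $(G,H)$. A *1-hop subgraph GNN* computes vertex features $h_i^{(0)}=f^{(0)}(h_i)$ and, for $l=1,\dots,L$, $$h_i^{(l)}=f^{(l)}\Big(h_i^{(l-1)},\,g^{(l)}\big((G,h^{(l-1)})_{v_i,1}\big)\Big),\qquad i=1,\dots,n,$$ where $(G,h^{(l-1)})_{v_i,1}$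 is the subgraph of $G$ induced on $v_i$ and its neighbours, rooted at $v_i$, each vertex carrying its feature from $h^{(l-1)}$. Its output is, at graph level, the number $y=r\big(\mathrm{AGGR}(\{\{h_1^{(L)},\dots,h_n^{(L)}\}\})\big)$ or, at vertex level, the vector $(r(h_1^{(L)}),\dots,r(h_n^{(L)}))\in\mathbb R^n$. Here the number of layers $L$ is arbitrary, all intermediate features lie in Euclidean spaces of arbitrary finite dimensions, the maps $f^{(l)},g^{(l)},r$ are arbitrary continuous maps, with $g^{(l)}$ taking equal values on isomorphic rooted graphs with features (isomorphisms preserving root and features), and $\mathrm{AGGR}$ is a fixed one of the three operations sum, average, coordinatewise maximum. Let $\mathcal F_1$ be the set of all functions $\mathcal G_{n,m}\to\mathbb R$ computed by 1-hop subgraph GNNs with graph-level output (with this choice of $\mathrm{AGGR}$), and $\mathcal F_{1,v}$ the set of all functions $\mathcal G_{n,m}\to\mathbb R^n$ computed by 1-hop subgraph GNNs with vertex-level output. Let $\mathbb P$ be a Borel probability measure on $\mathcal G_{n,m}$ such that for $\mathbb P$-almost every $(G,H)$ the graph $G$ is connected and has no cycle of length greater than $3$. Then the following hold, with (i) holding for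 each of the three choices of $\mathrm{AGGR}$. (i) For all $\epsilon,\delta>0$ and every permutation-invariant continuous function $\Phi:\mathcal G_{n,m}\to\mathbb R$, there exists $F\in\mathcal F_1$ such that $$\mathbb P\big[\,|F(G,H)-\Phi(G,H)|>\delta\,\big]<\epsilon .$$ (ii) For all $\epsilon,\delta>0$ and every permutation-equivariant continuous function $\Phi_v:\mathcal G_{n,m}\to\mathbb R^n$, there exists $F_v\in\mathcal F_{1,v}$ such that $$\mathbb P\big[\,\|F_v(G,H)-\Phi_v(G,H)\|>\delta\,\big]<\epsilon ,$$ where $\|\cdot\|$ is the $\ell_2$-norm on $\mathbb R^n$. -/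

import Mathlib

open MeasureTheory

namespace SubgraphGNN

/-- The Euclidean space of dimension `d`, in which vertex features take their values. -/
abbrev Feat (d : ℕ) : Type := EuclideanSpace ℝ (Fin d)

/-- Undirected unweighted graphs on the vertices `Fin n`, each vertex carrying a feature
in `ℝ^m`. -/
@[ext]
structure FeaturedGraph (n m : ℕ) : Type where
  graph : SimpleGraph (Fin n)
  feat : Fin n → Feat m

/-- A featured graph as a pair (graph, features). -/
def FeaturedGraph.toPair {n m : ℕ} (X : FeaturedGraph n m) :
    SimpleGraph (Fin n) × (Fin n → Feat m) := (X.graph, X.feat)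

/-- The product of the discrete topology on graphs and the Euclidean topology on features. -/
instance (n m : ℕ) : TopologicalSpace (FeaturedGraph n m) :=
  letI : TopologicalSpace (SimpleGraph (Fin n)) := ⊥
  TopologicalSpace.induced FeaturedGraph.toPair inferInstance

instance (n m : ℕ) : MeasurableSpace (FeaturedGraph n m) := borel _

instance (n m : ℕ) : BorelSpace (FeaturedGraph n m) := ⟨rfl⟩

/-- Relabelling of the vertices: the vertex `i` becomes the vertex `σ i`. -/
def FeaturedGraph.relabel {n m : ℕ} (σ : Equiv.Perm (Fin n)) (X : FeaturedGraph n m) :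
    FeaturedGraph n m where
  graph := X.graph.map σ.toEmbedding
  feat := fun i => X.feat (σ.symm i)

/-- `Φ (σ ∗ X) = Φ X` for every permutation `σ`. -/
def PermInvariant {n m : ℕ} (Φ : FeaturedGraph n m → ℝ) : Prop :=
  ∀ (σ : Equiv.Perm (Fin n)) (X : FeaturedGraph n m), Φ (X.relabel σ) = Φ X

/-- `Φ (σ ∗ X) = σ (Φ X)` for every permutation `σ`, where `σ` moves the entry number `i` of a
vector to the position `σ i`. -/
def PermEquivariant {n m : ℕ} (Φ : FeaturedGraph n m → EuclideanSpace ℝ (Fin n)) : Prop :=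
  ∀ (σ : Equiv.Perm (Fin n)) (X : FeaturedGraph n m) (i : Fin n),
    Φ (X.relabel σ) i = Φ X (σ.symm i)

/-- A finite rooted graph whose vertices carry features in `ℝ^d`. -/
structure RootedGraph (d : ℕ) : Type 1 where
  V : Type
  [finite : Finite V]
  graph : SimpleGraph V
  root : V
  feat : V → Feat d

/-- Isomorphism of rooted graphs with features: a graph isomorphism that respects the root and
all the features. -/
def RootedGraph.Isomorphic {d : ℕ} (A B : RootedGraph d) : Prop :=
  ∃ e : A.graph ≃g B.graph, e A.root = B.root ∧ ∀ u, B.feat (e u) = A.feat u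

/-- The admissible functions of rooted graphs: they take the same value on isomorphic rooted
graphs and are continuous in the features (the graph and the root being discrete data). -/
structure IsAdmissible {d e : ℕ} (g : RootedGraph d → Feat e) : Prop where
  eq_of_isomorphic : ∀ A B : RootedGraph d, A.Isomorphic B → g A = g B
  continuous : ∀ (V : Type) [Finite V] (G : SimpleGraph V) (v : V),
    Continuous fun x : V → Feat d => g ⟨V, G, v, x⟩

/-- `N_k(v)`: the vertices at shortest-path distance at most `k` from `v`. -/
def nbhd {n : ℕ} (G : SimpleGraph (Fin n)) (k : ℕ) (v : Fin n) : Set (Fin n) :=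
  {u | G.edist u v ≤ k}

theorem mem_nbhd_self {n : ℕ} (G : SimpleGraph (Fin n)) (k : ℕ) (v : Fin n) :
    v ∈ nbhd G k v := by
  simp [nbhd]

/-- `(G, h)_{v,k}`: the subgraph of `G` induced on `N_k(v)`, rooted at `v`, with features `h`. -/
def hopSubgraph {n d : ℕ} (G : SimpleGraph (Fin n)) (h : Fin n → Feat d) (k : ℕ) (v : Fin n) :
    RootedGraph d where
  V := nbhd G k v
  graph := G.induce (nbhd G k v)
  root := ⟨v, mem_nbhd_self G k v⟩
  feat := fun u => h u

/-- `IsHidden k d h` says that `h`, which sends a graph to a feature in `ℝ^d` for each of its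
vertices, is what some `k`-hop subgraph GNN computes after its embedding layer and any finite
number of aggregation layers. -/
inductive IsHidden {n m : ℕ} (k : ℕ) :
    (d : ℕ) → (FeaturedGraph n m → Fin n → Feat d) → Prop
  | embedding {d : ℕ} (f : Feat m → Feat d) (hf : Continuous f) :
      IsHidden k d (fun X i => f (X.feat i))
  | layer {d e d' : ℕ} {h : FeaturedGraph n m → Fin n → Feat d} (hh : IsHidden k d h)
      (g : RootedGraph d → Feat e) (hg : IsAdmissible g)
      (f : Feat d × Feat e → Feat d') (hf : Continuous f) :
      IsHidden k d' (fun X i => f (h X i, g (hopSubgraph X.graph (h X) k i)))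

/-- The permutation-invariant aggregation operations. -/
inductive Aggregator : Type
  | sum
  | mean
  | max

/-- Aggregation of the features of all the vertices; the maximum is taken coordinatewise. -/
noncomputable def Aggregator.aggr {n d : ℕ} : Aggregator → (Fin n → Feat d) → Feat d
  | .sum, h => ∑ i, h i
  | .mean, h => (n : ℝ)⁻¹ • ∑ i, h i
  | .max, h => WithLp.toLp 2 fun c => ⨆ i, h i c

/-- `F_k`: the `k`-hop subgraph GNNs with graph-level output, for the given aggregation. -/
def graphGNN (a : Aggregator) (n m k : ℕ) : Set (FeaturedGraph n m → ℝ) :=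
  {F | ∃ (d : ℕ) (h : FeaturedGraph n m → Fin n → Feat d) (r : Feat d → ℝ),
    IsHidden k d h ∧ Continuous r ∧ F = fun X => r (a.aggr (h X))}

/-- `F_{k,v}`: the `k`-hop subgraph GNNs with vertex-level output. -/
def vertexGNN (n m k : ℕ) : Set (FeaturedGraph n m → EuclideanSpace ℝ (Fin n)) :=
  {F | ∃ (d : ℕ) (h : FeaturedGraph n m → Fin n → Feat d) (r : Feat d → ℝ),
    IsHidden k d h ∧ Continuous r ∧ F = fun X => WithLp.toLp 2 fun i => r (h X i)}

/-- No cycle of `G` is longer than `c`. -/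
def NoCycleLongerThan {n : ℕ} (G : SimpleGraph (Fin n)) (c : ℕ) : Prop :=
  ∀ (v : Fin n) (p : G.Walk v v), p.IsCycle → p.length ≤ c

end SubgraphGNN

/-! Up to small probability the data lie in a compact set `K` of connected featured graphs whose
cycles are triangles. The scalar networks form a subalgebra of the continuous functions of (graph,
vertex) on `K × Fin n`. By Stone-Weierstrass, a continuous function is uniformly approximable there
once it is constant on the pairs that no network distinguishes. So it suffices that
indistinguishable pairs (X, i), (Y, j) differ by a relabelling carrying i to j
(`Indistinguishable.exists_relabel`).

Colour each vertex of the disjoint union of X and Y by its values under all scalar networks. A layer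
can test whether a rooted neighbourhood is isomorphic to a given one, so this colouring is stable:
equal colours force isomorphic coloured neighbourhoods (`Indistinguishable.exists_iso`).

The combinatorial core is `IsStable.exists_colorAut`: in a finite graph whose only cycles are
triangles, equally coloured vertices of a stable colouring are exchanged by a colour-preserving
automorphism. It goes by induction, stripping the pendant vertices, as one strips the leaves of a
tree. By connectedness, an automorphism of the union taking i to j maps X onto Y. -/

namespace SubgraphGNN

/-! ### Stable colourings of graphs whose cycles are triangles -/

section Combinatorics

variable {V C : Type}

/-- The closed neighbourhood of a vertex. -/
def closedNbhd (G : SimpleGraph V) (x : V) : Set V := {y | y = x ∨ G.Adj x y}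

theorem self_mem_closedNbhd (G : SimpleGraph V) (x : V) : x ∈ closedNbhd G x := Or.inl rfl

theorem mem_closedNbhd_comm {G : SimpleGraph V} {x y : V} :
    x ∈ closedNbhd G y ↔ y ∈ closedNbhd G x := by
  simp only [closedNbhd, Set.mem_ofPred_eq, G.adj_comm x y, eq_comm]

/-- One can walk from `a` to `b` without meeting `x`. -/
def ReachableAvoiding (G : SimpleGraph V) (x : V) : V → V → Prop :=
  Relation.ReflTransGen fun p q => G.Adj p q ∧ p ≠ x ∧ q ≠ x

theorem ReachableAvoiding.symm {G : SimpleGraph V} {x a b : V} (h : ReachableAvoiding G x a b) :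
    ReachableAvoiding G x b a := by
  induction h with
  | refl => exact .refl
  | tail _ hbc ih => exact .head ⟨hbc.1.symm, hbc.2.2, hbc.2.1⟩ ih

/-- A form of the condition that all cycles are triangles which passes easily to induced subgraphs
and disjoint unions. -/
structure IsTriangleCactus (G : SimpleGraph V) : Prop where
  adj_of_reachable : ∀ x a b, G.Adj x a → G.Adj x b → a ≠ b → ReachableAvoiding G x a b → G.Adj a b
  no_four_cycle : ∀ a b c d, G.Adj a b → G.Adj b c → G.Adj c d → G.Adj d a → a ≠ c → b ≠ d → False

theorem ReachableAvoiding.exists_path {G : SimpleGraph V} {x a b : V} (hax : a ≠ x)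
    (h : ReachableAvoiding G x a b) : ∃ p : G.Walk a b, p.IsPath ∧ x ∉ p.support := by
  classical
  suffices ∃ p : G.Walk a b, x ∉ p.support by
    obtain ⟨p, hp⟩ := this
    exact ⟨p.bypass, p.bypass_isPath, fun hx => hp (p.support_bypass_subset_support hx)⟩
  induction h with
  | refl => exact ⟨.nil, by simpa using hax.symm⟩
  | tail _ hbc ih =>
    obtain ⟨p, hp⟩ := ih
    refine ⟨p.concat hbc.1, ?_⟩
    rw [SimpleGraph.Walk.support_concat]
    simp [hp, hbc.2.2.symm]

/-- A path avoiding `x` between two neighbours of `x` closes up through `x` to a cycle two edges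
longer, so it is a single edge. -/
theorem isTriangleCactus_of_cycle_length_le {G : SimpleGraph V}
    (h : ∀ (v : V) (p : G.Walk v v), p.IsCycle → p.length ≤ 3) : IsTriangleCactus G := by
  have key : ∀ (x a b : V) (_ : G.Adj x a) (_ : G.Adj b x) (_ : a ≠ b) (p : G.Walk a b),
      p.IsPath → x ∉ p.support → p.length ≤ 1 := by
    intro x a b hxa hbx hab p hp hx
    have hc : (SimpleGraph.Walk.cons hxa (p.concat hbx)).IsCycle := by
      rw [SimpleGraph.Walk.cons_isCycle_iff]
      refine ⟨(SimpleGraph.Walk.concat_isPath_iff _).2 ⟨hp, hx⟩, ?_⟩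
      rw [SimpleGraph.Walk.edges_concat]
      simp only [List.concat_eq_append, List.mem_append, List.mem_singleton, not_or]
      refine ⟨fun he => hx (p.fst_mem_support_of_mem_edges he), ?_⟩
      rw [Sym2.eq_iff]
      rintro (⟨h1, h2⟩ | ⟨-, h2⟩)
      · exact hbx.ne h1.symm
      · exact hab h2
    have := h x _ hc
    simp at this
    omega
  refine ⟨fun x a b hxa hxb hab hr => ?_, fun a b c d hab hbc hcd hda hac hbd => ?_⟩
  · obtain ⟨p, hp, hx⟩ := hr.exists_path hxa.ne'
    have := key x a b hxa hxb.symm hab p hp hx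
    cases p with
    | nil => exact absurd rfl hab
    | cons e q =>
      cases q with
      | nil => exact e
      | cons _ _ => simp at this
  · have := key a b d hab hda hbd (.cons hbc (.cons hcd .nil))
      (by simp [SimpleGraph.Walk.cons_isPath_iff, hbc.ne, hbd, hcd.ne])
      (by simp [hab.ne, hac, hda.ne'])
    simp at this

theorem IsTriangleCactus.comap {W : Type} {G : SimpleGraph V} (hG : IsTriangleCactus G)
    (f : W ↪ V) : IsTriangleCactus (G.comap f) := by
  refine ⟨fun x a b hxa hxb hab hr => ?_, fun a b c d hab hbc hcd hda hac hbd => ?_⟩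
  · refine hG.adj_of_reachable (f x) (f a) (f b) hxa hxb (f.injective.ne hab) ?_
    clear hxb hab
    induction hr with
    | refl => exact .refl
    | tail _ h ih => exact ih.tail ⟨h.1, f.injective.ne h.2.1, f.injective.ne h.2.2⟩
  · exact hG.no_four_cycle _ _ _ _ hab hbc hcd hda (f.injective.ne hac) (f.injective.ne hbd)

/-- A vertex is pendant if it has at most one neighbour that is not a twin of it. -/
def IsPendant (G : SimpleGraph V) (x : V) : Prop :=
  {y ∈ closedNbhd G x | closedNbhd G y ≠ closedNbhd G x}.Subsingleton

/-- Extremal choice: take an oriented edge (s, a) for which the branch reachable from a without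
meeting s is smallest. Then a is pendant, with s as its only possible non-twin. -/
theorem IsTriangleCactus.exists_isPendant [Finite V] [Nonempty V] {G : SimpleGraph V}
    (hG : IsTriangleCactus G) : ∃ x, IsPendant G x := by
  by_cases hE : ∃ s a, G.Adj s a
  swap
  · push Not at hE
    obtain ⟨x⟩ := ‹Nonempty V›
    refine ⟨x, ?_⟩
    rintro y ⟨hy | hy, hy'⟩
    · exact absurd (by rw [hy]) hy'
    · exact absurd hy (hE _ _)
  obtain ⟨s₀, a₀, h₀⟩ := hE
  obtain ⟨⟨s, a⟩, hsa, hmin⟩ := Set.exists_min_image {p : V × V | G.Adj p.1 p.2}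
    (fun p => {y | ReachableAvoiding G p.1 p.2 y}.ncard) (Set.toFinite _) ⟨(s₀, a₀), h₀⟩
  simp only [Set.mem_ofPred_eq, Prod.forall] at hsa hmin
  -- If b were not adjacent to s, its branch avoiding a' could not reach s. It would lie in the
  -- minimal branch and miss a', contradicting minimality.
  have key : ∀ a', G.Adj s a' → ReachableAvoiding G s a a' → ∀ b, G.Adj a' b → b ≠ s → G.Adj s b := by
    intro a' hsa' har b hab hbs
    by_contra hsb
    have hsub : ∀ y, ReachableAvoiding G a' b y → y ≠ s ∧ ReachableAvoiding G s a y := by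
      intro y hy
      induction hy with
      | refl => exact ⟨hbs, har.tail ⟨hab, hsa'.ne', hbs⟩⟩
      | tail hy hyz ih =>
        rename_i z
        have hzs : z ≠ s := by
          rintro rfl
          exact hsb (hG.adj_of_reachable a' _ _ hab hsa'.symm hbs (hy.tail hyz)).symm
        exact ⟨hzs, ih.2.tail ⟨hyz.1, ih.1, hzs⟩⟩
    have hlt : {y | ReachableAvoiding G a' b y}.ncard < {y | ReachableAvoiding G s a y}.ncard := by
      refine Set.ncard_lt_ncard ⟨fun y hy => (hsub y hy).2, fun hss => ?_⟩ (Set.toFinite _)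
      have h1 : ReachableAvoiding G a' b a' := hss har
      rcases Relation.ReflTransGen.cases_tail h1 with h2 | ⟨_, _, h2⟩
      · exact hab.ne h2
      · exact h2.2.2 rfl
    exact absurd (hmin a' b hab) (not_le.2 hlt)
  refine ⟨a, ?_⟩
  suffices h : ∀ y ∈ closedNbhd G a, closedNbhd G y ≠ closedNbhd G a → y = s by
    rintro y ⟨hy, hy'⟩ z ⟨hz, hz'⟩
    rw [h y hy hy', h z hz hz']
  rintro y (rfl | hay) hne
  · exact absurd rfl hne
  by_contra hys
  have hsy := key a hsa .refl y hay hys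
  have hy : ReachableAvoiding G s a y := .single ⟨hay, hsa.ne', hys⟩
  refine hne (Set.Subset.antisymm ?_ ?_)
  · rintro t (rfl | hyt)
    · exact Or.inr hay
    by_cases hts : t = s
    · exact hts ▸ Or.inr hsa.symm
    by_cases hta : t = a
    · exact Or.inl hta
    exact (hG.no_four_cycle t y a s hyt.symm hay.symm hsa.symm (key y hsy hy t hyt hts) hta hys).elim
  · rintro t (rfl | hat)
    · exact Or.inr hay.symm
    by_cases hts : t = s
    · exact hts ▸ Or.inr hsy.symm
    by_cases hty : t = y
    · exact Or.inl hty
    exact (hG.no_four_cycle t a y s hat.symm hay hsy.symm (key a hsa .refl t hat hts) hty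
      hsa.ne').elim

/-- The map `ψ` restricts to an embedding of the closed neighbourhood of `u` into that of `w`,
preserving colours. -/
structure IsLocalEmbedding (G : SimpleGraph V) (c : V → C) (u w : V) (ψ : V → V) : Prop where
  map_root : ψ u = w
  injOn : Set.InjOn ψ (closedNbhd G u)
  color : ∀ x ∈ closedNbhd G u, c (ψ x) = c x
  adj : ∀ x ∈ closedNbhd G u, ∀ y ∈ closedNbhd G u, G.Adj x y → G.Adj (ψ x) (ψ y)

/-- Vertices of the same colour have isomorphic coloured neighbourhoods. -/
def IsStable (G : SimpleGraph V) (c : V → C) : Prop :=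
  ∀ u w, c u = c w → ∃ ψ, IsLocalEmbedding G c u w ψ

theorem IsLocalEmbedding.mapsTo {G : SimpleGraph V} {c : V → C} {u w : V} {ψ : V → V}
    (h : IsLocalEmbedding G c u w ψ) : Set.MapsTo ψ (closedNbhd G u) (closedNbhd G w) := by
  rintro x (rfl | hx)
  · exact Or.inl h.map_root
  · exact Or.inr (h.map_root ▸ h.adj u (self_mem_closedNbhd _ _) x (Or.inr hx) hx)

theorem IsStable.ncard_closedNbhd_le [Finite V] {G : SimpleGraph V} {c : V → C}
    (hc : IsStable G c) {u w : V} (h : c u = c w) :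
    (closedNbhd G u).ncard ≤ (closedNbhd G w).ncard := by
  obtain ⟨ψ, hψ⟩ := hc u w h
  exact Set.ncard_le_ncard_of_injOn ψ hψ.mapsTo hψ.injOn (Set.toFinite _)

theorem IsStable.ncard_closedNbhd_eq [Finite V] {G : SimpleGraph V} {c : V → C}
    (hc : IsStable G c) {u w : V} (h : c u = c w) :
    (closedNbhd G u).ncard = (closedNbhd G w).ncard :=
  (hc.ncard_closedNbhd_le h).antisymm (hc.ncard_closedNbhd_le h.symm)

/-- Stability gives embeddings in both directions, so the neighbourhoods have equal size and an
injection is onto. -/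
theorem IsLocalEmbedding.surjOn [Finite V] {G : SimpleGraph V} {c : V → C}
    (hc : IsStable G c) {u w : V} (h : c u = c w) {ψ : V → V}
    (hψ : IsLocalEmbedding G c u w ψ) : Set.SurjOn ψ (closedNbhd G u) (closedNbhd G w) := by
  have : ψ '' closedNbhd G u = closedNbhd G w := by
    refine Set.eq_of_subset_of_ncard_le hψ.mapsTo.image_subset ?_ (Set.toFinite _)
    rw [Set.InjOn.ncard_image hψ.injOn, hc.ncard_closedNbhd_eq h]
  exact this.ge

/-- Twins of the root go to twins of the root: adjacency gives one inclusion, and colours determine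
the sizes. -/
theorem IsLocalEmbedding.closedNbhd_eq [Finite V] {G : SimpleGraph V} {c : V → C}
    (hc : IsStable G c) {u w : V} (h : c u = c w) {ψ : V → V}
    (hψ : IsLocalEmbedding G c u w ψ) {z : V} (hz : closedNbhd G z = closedNbhd G u) :
    closedNbhd G (ψ z) = closedNbhd G w := by
  have hzu : z ∈ closedNbhd G u := hz ▸ self_mem_closedNbhd G z
  refine (Set.eq_of_subset_of_ncard_le ?_ ?_ (Set.toFinite _)).symm
  · intro t ht
    obtain ⟨y, hy, rfl⟩ := hψ.surjOn hc h ht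
    rcases (hz ▸ hy : y ∈ closedNbhd G z) with rfl | hzy
    · exact self_mem_closedNbhd _ _
    · exact Or.inr (hψ.adj z hzu y hy hzy)
  · rw [hc.ncard_closedNbhd_eq (hψ.color z hzu), hz, hc.ncard_closedNbhd_eq h]

theorem IsStable.isPendant [Finite V] {G : SimpleGraph V} {c : V → C} (hc : IsStable G c)
    {u w : V} (h : c u = c w) (hu : IsPendant G u) : IsPendant G w := by
  obtain ⟨ψ, hψ⟩ := hc u w h
  rintro y ⟨hy, hy'⟩ z ⟨hz, hz'⟩
  obtain ⟨y, hyu, rfl⟩ := hψ.surjOn hc h hy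
  obtain ⟨z, hzu, rfl⟩ := hψ.surjOn hc h hz
  rw [hu ⟨hyu, fun h' => hy' (hψ.closedNbhd_eq hc h h')⟩
    ⟨hzu, fun h' => hz' (hψ.closedNbhd_eq hc h h')⟩]

theorem IsStable.isPendant_iff [Finite V] {G : SimpleGraph V} {c : V → C} (hc : IsStable G c)
    {u w : V} (h : c u = c w) : IsPendant G u ↔ IsPendant G w :=
  ⟨hc.isPendant h, hc.isPendant h.symm⟩

theorem IsPendant.of_closedNbhd_eq {G : SimpleGraph V} {x y : V} (hx : IsPendant G x)
    (h : closedNbhd G y = closedNbhd G x) : IsPendant G y := by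
  rw [IsPendant, h]; exact hx

/-- Otherwise each is the only non-twin of the other. All else near `x` is a twin of `x`, hence
adjacent to `y`; a vertex near `y` but not near `x` would be a second non-twin of `y`. -/
theorem IsPendant.closedNbhd_eq {G : SimpleGraph V} {x y : V} (hx : IsPendant G x)
    (hy : IsPendant G y) (hxy : G.Adj x y) : closedNbhd G x = closedNbhd G y := by
  by_contra hne
  have twin : ∀ z ∈ closedNbhd G x, z ≠ y → closedNbhd G z = closedNbhd G x := by
    intro z hz hzy
    by_contra h
    exact hzy (hx ⟨hz, h⟩ ⟨Or.inr hxy, fun h => hne h.symm⟩)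
  have hsub : closedNbhd G x ⊆ closedNbhd G y := by
    intro z hz
    by_cases hzy : z = y
    · exact Or.inl hzy
    · rw [mem_closedNbhd_comm, twin z hz hzy]
      exact Or.inr hxy
  obtain ⟨z, hzy, hzx⟩ : ∃ z ∈ closedNbhd G y, z ∉ closedNbhd G x := by
    by_contra! h
    exact hne (hsub.antisymm h)
  have hz : closedNbhd G z ≠ closedNbhd G y := by
    intro h
    exact hzx (mem_closedNbhd_comm.1 (h ▸ Or.inr hxy.symm))
  have := hy ⟨hzy, hz⟩ ⟨Or.inr hxy.symm, hne⟩
  exact hzx (this ▸ self_mem_closedNbhd _ _)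

theorem IsPendant.eq_of_adj {G : SimpleGraph V} {x s t : V} (hx : IsPendant G x)
    (hs : ¬ IsPendant G s) (ht : ¬ IsPendant G t) (hxs : G.Adj x s) (hxt : G.Adj x t) : s = t :=
  hx ⟨Or.inr hxs, fun h => hs (hx.of_closedNbhd_eq h)⟩
    ⟨Or.inr hxt, fun h => ht (hx.of_closedNbhd_eq h)⟩

/-- Colour-preserving automorphisms. -/
def IsColorAut (G : SimpleGraph V) (c : V → C) (σ : Equiv.Perm V) : Prop :=
  (∀ x y, G.Adj x y → G.Adj (σ x) (σ y)) ∧ ∀ x, c (σ x) = c x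

theorem IsColorAut.adj_iff [Finite V] {G : SimpleGraph V} {c : V → C} {σ : Equiv.Perm V}
    (h : IsColorAut G c σ) (x y : V) : G.Adj (σ x) (σ y) ↔ G.Adj x y := by
  refine ⟨fun hxy => ?_, h.1 x y⟩
  -- By finite order some positive power of `σ` is the identity, so adjacency of the images returns
  -- to `x` and `y`.
  have hpow : ∀ k : ℕ, G.Adj ((σ ^ (k + 1)) x) ((σ ^ (k + 1)) y) := by
    intro k
    induction k with
    | zero => simpa using hxy
    | succ k ih => rw [pow_succ' σ (k + 1)]; exact h.1 _ _ ih
  have := hpow (orderOf σ - 1)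
  rwa [Nat.sub_add_cancel (orderOf_pos σ), pow_orderOf_eq_one] at this

theorem IsStable.comap_subtype {G : SimpleGraph V} {c : V → C} (hc : IsStable G c)
    (p : V → Prop) (hp : ∀ x y, c x = c y → p x → p y) :
    IsStable (G.comap (Function.Embedding.subtype p)) (fun x => c x) := by
  classical
  intro u w huw
  obtain ⟨ψ, hψ⟩ := hc u w huw
  have hN : ∀ x : Subtype p, x ∈ closedNbhd (G.comap (Function.Embedding.subtype p)) u →
      (x : V) ∈ closedNbhd G u := by
    rintro x (rfl | hx)
    · exact Or.inl rfl
    · exact Or.inr hx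
  have hpψ : ∀ x : Subtype p, x ∈ closedNbhd (G.comap (Function.Embedding.subtype p)) u →
      p (ψ x) := fun x hx => hp _ _ (hψ.color x (hN x hx)).symm x.2
  let f : Subtype p → Subtype p := fun x => if h : p (ψ x) then ⟨ψ x, h⟩ else w
  have hf : ∀ x : Subtype p, x ∈ closedNbhd (G.comap (Function.Embedding.subtype p)) u →
      (f x : V) = ψ x := fun x hx => by simp [f, hpψ x hx]
  refine ⟨f, ?_, ?_, ?_, ?_⟩
  · exact Subtype.ext ((hf u (self_mem_closedNbhd _ _)).trans hψ.map_root)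
  · intro x hx y hy hxy
    exact Subtype.ext (hψ.injOn (hN x hx) (hN y hy) (by rw [← hf x hx, ← hf y hy, hxy]))
  · intro x hx
    rw [hf x hx]
    exact hψ.color x (hN x hx)
  · intro x hx y hy hxy
    change G.Adj (f x) (f y)
    rw [hf x hx, hf y hy]
    exact hψ.adj x (hN x hx) y (hN y hy) hxy

/-- A pendant vertex with a non-pendant neighbour has exactly one, its anchor s, and is moved by the
local embedding of s into the neighbourhood of `φ s`. Pendant vertices without an anchor stay fixed.
The image is anchored at `φ s`, so s can be recovered, which gives injectivity. -/
theorem IsStable.exists_colorAut_extension [Finite V] {G : SimpleGraph V} {c : V → C}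
    (hc : IsStable G c) (φ : Equiv.Perm {x // ¬ IsPendant G x})
    (hφ : IsColorAut (G.comap (Function.Embedding.subtype fun x => ¬ IsPendant G x))
      (fun x => c x) φ) :
    ∃ σ : Equiv.Perm V, IsColorAut G c σ ∧ ∀ x : {x // ¬ IsPendant G x}, σ x = φ x := by
  classical
  choose ψ hψ using fun s : {x // ¬ IsPendant G x} => hc s (φ s) (hφ.2 s).symm
  have hψm : ∀ (s : {x // ¬ IsPendant G x}) x, G.Adj x s → x ∈ closedNbhd G s :=
    fun s x h => Or.inr h.symm
  obtain ⟨f, hf₁, hf₂, hf₃⟩ : ∃ f : V → V, (∀ x : {x // ¬ IsPendant G x}, f x = φ x) ∧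
      (∀ x (s : {x // ¬ IsPendant G x}), IsPendant G x → G.Adj x s → f x = ψ s x) ∧
      (∀ x, IsPendant G x → (∀ s : {x // ¬ IsPendant G x}, ¬ G.Adj x s) → f x = x) := by
    refine ⟨fun x => if h : ¬ IsPendant G x then φ ⟨x, h⟩ else
      if h' : ∃ s : {x // ¬ IsPendant G x}, G.Adj x s then ψ h'.choose x else x, ?_, ?_, ?_⟩
    · intro x
      simp [x.2]
    · intro x s hx hxs
      have h' : ∃ s : {x // ¬ IsPendant G x}, G.Adj x s := ⟨s, hxs⟩
      have : h'.choose = s := Subtype.ext (hx.eq_of_adj h'.choose.2 s.2 h'.choose_spec hxs)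
      simp [hx, h', this]
    · intro x hx hs
      have h' : ¬ ∃ s : {x // ¬ IsPendant G x}, G.Adj x s := fun ⟨s, h⟩ => hs s h
      simp only [hx, not_true_eq_false, dite_false, h']
  have hcol : ∀ x, c (f x) = c x := by
    intro x
    by_cases hx : IsPendant G x
    · by_cases h' : ∃ s : {x // ¬ IsPendant G x}, G.Adj x s
      · obtain ⟨s, hs⟩ := h'
        rw [hf₂ x s hx hs]
        exact (hψ s).color x (hψm s x hs)
      · push Not at h'
        rw [hf₃ x hx h']
    · rw [hf₁ ⟨x, hx⟩]
      exact hφ.2 ⟨x, hx⟩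
  have hpend : ∀ x, IsPendant G (f x) ↔ IsPendant G x := fun x => hc.isPendant_iff (hcol x)
  have hatt : ∀ x (s : {x // ¬ IsPendant G x}), IsPendant G x → G.Adj x s →
      G.Adj (f x) (φ s) := by
    intro x s hx hs
    rw [hf₂ x s hx hs, ← (hψ s).map_root]
    exact (hψ s).adj x (hψm s x hs) s (self_mem_closedNbhd _ _) hs
  have hinj : Function.Injective f := by
    intro x y hxy
    have hpxy : IsPendant G x ↔ IsPendant G y := by rw [← hpend x, hxy, hpend y]
    by_cases hx : IsPendant G x
    · have hy := hpxy.1 hx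
      by_cases hxs : ∃ s : {x // ¬ IsPendant G x}, G.Adj x s
      · obtain ⟨s, hs⟩ := hxs
        by_cases hyt : ∃ t : {x // ¬ IsPendant G x}, G.Adj y t
        · obtain ⟨t, ht⟩ := hyt
          have h1 : φ s = φ t := Subtype.ext <|
            ((hpend x).2 hx).eq_of_adj (φ s).2 (φ t).2 (hatt x s hx hs) (hxy ▸ hatt y t hy ht)
          obtain rfl := φ.injective h1
          refine (hψ s).injOn (hψm s x hs) (hψm s y ht) ?_
          rw [← hf₂ x s hx hs, ← hf₂ y s hy ht, hxy]
        · push Not at hyt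
          have := hatt x s hx hs
          rw [hxy, hf₃ y hy hyt] at this
          exact (hyt _ this).elim
      · push Not at hxs
        by_cases hyt : ∃ t : {x // ¬ IsPendant G x}, G.Adj y t
        · obtain ⟨t, ht⟩ := hyt
          have := hatt y t hy ht
          rw [← hxy, hf₃ x hx hxs] at this
          exact (hxs _ this).elim
        · push Not at hyt
          rwa [hf₃ x hx hxs, hf₃ y hy hyt] at hxy
    · have hy : ¬ IsPendant G y := fun h => hx (hpxy.2 h)
      rw [hf₁ ⟨x, hx⟩, hf₁ ⟨y, hy⟩] at hxy
      exact congrArg Subtype.val (φ.injective (Subtype.ext hxy))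
  have hadj : ∀ x y, G.Adj x y → G.Adj (f x) (f y) := by
    intro x y hxy
    by_cases hx : IsPendant G x
    · by_cases hy : IsPendant G y
      · have hN := hx.closedNbhd_eq hy hxy
        have hiff : ∀ s : {x // ¬ IsPendant G x}, G.Adj x s → G.Adj y s := by
          intro s hs
          rcases (hN ▸ Or.inr hs : (s : V) ∈ closedNbhd G y) with h | h
          · exact (s.2 (h ▸ hy)).elim
          · exact h
        by_cases hxs : ∃ s : {x // ¬ IsPendant G x}, G.Adj x s
        · obtain ⟨s, hs⟩ := hxs
          rw [hf₂ x s hx hs, hf₂ y s hy (hiff s hs)]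
          exact (hψ s).adj x (hψm s x hs) y (hψm s y (hiff s hs)) hxy
        · push Not at hxs
          have hys : ∀ s : {x // ¬ IsPendant G x}, ¬ G.Adj y s := by
            intro s hs
            rcases (hN.symm ▸ Or.inr hs : (s : V) ∈ closedNbhd G x) with h | h
            · exact s.2 (h ▸ hx)
            · exact hxs s h
          rwa [hf₃ x hx hxs, hf₃ y hy hys]
      · rw [hf₁ ⟨y, hy⟩]
        exact hatt x ⟨y, hy⟩ hx hxy
    · by_cases hy : IsPendant G y
      · rw [hf₁ ⟨x, hx⟩]
        exact (hatt y ⟨x, hx⟩ hy hxy.symm).symm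
      · rw [hf₁ ⟨x, hx⟩, hf₁ ⟨y, hy⟩]
        exact hφ.1 ⟨x, hx⟩ ⟨y, hy⟩ hxy
  exact ⟨Equiv.ofBijective f (Finite.injective_iff_bijective.1 hinj), ⟨hadj, hcol⟩, hf₁⟩

/-- If `u` and `w` are twins, a transposition works. Otherwise their twin classes A and B are
disjoint cliques, exchanged by the local embedding and its inverse. Edges leaving either class end
at non-pendant vertices, which by `hs` see both classes. -/
theorem IsStable.exists_colorAut_of_isPendant [Finite V] {G : SimpleGraph V} {c : V → C}
    (hc : IsStable G c) {u w : V} (huw : c u = c w) (hu : IsPendant G u)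
    (hs : ∀ s, ¬ IsPendant G s → (G.Adj u s ↔ G.Adj w s)) :
    ∃ σ : Equiv.Perm V, IsColorAut G c σ ∧ σ u = w := by
  classical
  have hw : IsPendant G w := hc.isPendant huw hu
  have adj_of_mem : ∀ {x y z : V}, closedNbhd G x = closedNbhd G z → y ∈ closedNbhd G z → y ≠ x →
      G.Adj x y := by
    intro x y z h hy hne
    rcases (h ▸ hy : y ∈ closedNbhd G x) with h | h
    · exact absurd h hne
    · exact h
  by_cases hN : closedNbhd G u = closedNbhd G w
  · have hsw : ∀ z, closedNbhd G (Equiv.swap u w z) = closedNbhd G z := by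
      intro z
      by_cases hzu : z = u
      · rw [hzu, Equiv.swap_apply_left, hN]
      by_cases hzw : z = w
      · rw [hzw, Equiv.swap_apply_right, hN]
      rw [Equiv.swap_apply_of_ne_of_ne hzu hzw]
    refine ⟨Equiv.swap u w, ⟨fun x y hxy => ?_, fun x => ?_⟩, Equiv.swap_apply_left u w⟩
    · refine adj_of_mem (hsw x) ?_ ((Equiv.swap u w).injective.ne hxy.ne')
      rw [mem_closedNbhd_comm, hsw y]
      exact Or.inr hxy.symm
    · by_cases hzu : x = u
      · rw [hzu, Equiv.swap_apply_left, huw]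
      by_cases hzw : x = w
      · rw [hzw, Equiv.swap_apply_right, huw]
      rw [Equiv.swap_apply_of_ne_of_ne hzu hzw]
  obtain ⟨ψ, hψ⟩ := hc u w huw
  set A : Set V := {y | closedNbhd G y = closedNbhd G u} with hA
  set B : Set V := {y | closedNbhd G y = closedNbhd G w} with hB
  have hAN : ∀ x ∈ A, x ∈ closedNbhd G u := fun x hx => (hx : _ = _) ▸ self_mem_closedNbhd G x
  have hBN : ∀ x ∈ B, x ∈ closedNbhd G w := fun x hx => (hx : _ = _) ▸ self_mem_closedNbhd G x
  have hAB : ∀ x ∈ A, x ∉ B := fun x hx hx' => hN (hx.symm.trans hx')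
  have hmaps : ∀ x ∈ A, ψ x ∈ B := fun x hx => hψ.closedNbhd_eq hc huw hx
  have hsurj : ∀ y ∈ B, ∃ x ∈ A, ψ x = y := by
    intro y hy
    obtain ⟨x, hx, rfl⟩ := hψ.surjOn hc huw (hBN y hy)
    refine ⟨x, ?_, rfl⟩
    have hxp : IsPendant G x := hc.isPendant (hψ.color x hx) (hw.of_closedNbhd_eq hy)
    rcases hx with rfl | hx
    · rfl
    · exact (hu.closedNbhd_eq hxp hx).symm
  choose! g hgA hgψ using hsurj
  have hgψ' : ∀ x ∈ A, g (ψ x) = x := fun x hx =>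
    hψ.injOn (hAN _ (hgA _ (hmaps x hx))) (hAN x hx) (hgψ _ (hmaps x hx))
  let τ : V → V := fun x => if x ∈ A then ψ x else if x ∈ B then g x else x
  have hτA : ∀ x ∈ A, τ x = ψ x := fun x hx => if_pos hx
  have hτB : ∀ x ∈ B, τ x = g x := fun x hx => by
    simp only [τ, if_neg fun h => hAB x h hx, if_pos hx]
  have hτ : ∀ x, x ∉ A → x ∉ B → τ x = x := fun x hx hx' => by
    simp only [τ, if_neg hx, if_neg hx']
  have hinv : Function.Involutive τ := by
    intro x
    by_cases hxA : x ∈ A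
    · rw [hτA x hxA, hτB _ (hmaps x hxA), hgψ' x hxA]
    by_cases hxB : x ∈ B
    · rw [hτB x hxB, hτA _ (hgA x hxB), hgψ x hxB]
    rw [hτ x hxA hxB, hτ x hxA hxB]
  have hAp : ∀ x ∈ A, IsPendant G x := fun x hx => hu.of_closedNbhd_eq hx
  have hBp : ∀ x ∈ B, IsPendant G x := fun x hx => hw.of_closedNbhd_eq hx
  have hAo : ∀ x ∈ A, ∀ y, y ∉ A → G.Adj x y → ¬ IsPendant G y ∧ ∀ z ∈ B, G.Adj z y := by
    intro x hx y hy hxy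
    have hyp : ¬ IsPendant G y := fun h => hy (((hAp x hx).closedNbhd_eq h hxy).symm.trans hx)
    have huy : G.Adj u y := adj_of_mem (Eq.symm hx) (Or.inr hxy) fun h => hyp (h ▸ hu)
    exact ⟨hyp, fun z hz => adj_of_mem hz (Or.inr ((hs y hyp).1 huy)) fun h => hyp (h ▸ hBp z hz)⟩
  have hBo : ∀ x ∈ B, ∀ y, y ∉ B → G.Adj x y → ¬ IsPendant G y ∧ ∀ z ∈ A, G.Adj z y := by
    intro x hx y hy hxy
    have hyp : ¬ IsPendant G y := fun h => hy (((hBp x hx).closedNbhd_eq h hxy).symm.trans hx)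
    have hwy : G.Adj w y := adj_of_mem (Eq.symm hx) (Or.inr hxy) fun h => hyp (h ▸ hw)
    exact ⟨hyp, fun z hz => adj_of_mem hz (Or.inr ((hs y hyp).2 hwy)) fun h => hyp (h ▸ hAp z hz)⟩
  have hhalf : ∀ x y, G.Adj x y → x ∈ A ∨ x ∈ B → G.Adj (τ x) (τ y) := by
    rintro x y hxy (hx | hx)
    · by_cases hyA : y ∈ A
      · rw [hτA x hx, hτA y hyA]
        exact hψ.adj x (hAN x hx) y (hAN y hyA) hxy
      · have h := hAo x hx y hyA hxy
        rw [hτA x hx, hτ y hyA fun hyB => h.1 (hBp y hyB)]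
        exact h.2 _ (hmaps x hx)
    · by_cases hyB : y ∈ B
      · refine adj_of_mem (z := τ y) ?_ (self_mem_closedNbhd _ _) (hinv.injective.ne hxy.ne')
        rw [hτB x hx, hτB y hyB]
        exact (hgA x hx : _ = _).trans (Eq.symm (hgA y hyB))
      · have h := hBo x hx y hyB hxy
        rw [hτB x hx, hτ y (fun hyA => h.1 (hAp y hyA)) hyB]
        exact h.2 _ (hgA x hx)
  refine ⟨hinv.toPerm, ⟨fun x y hxy => ?_, fun x => ?_⟩, ?_⟩
  · change G.Adj (τ x) (τ y)
    by_cases hx : x ∈ A ∨ x ∈ B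
    · exact hhalf x y hxy hx
    by_cases hy : y ∈ A ∨ y ∈ B
    · exact (hhalf y x hxy.symm hy).symm
    push Not at hx hy
    rwa [hτ x hx.1 hx.2, hτ y hy.1 hy.2]
  · change c (τ x) = c x
    by_cases hxA : x ∈ A
    · rw [hτA x hxA, hψ.color x (hAN x hxA)]
    by_cases hxB : x ∈ B
    · rw [hτB x hxB, ← hψ.color _ (hAN _ (hgA x hxB)), hgψ x hxB]
    rw [hτ x hxA hxB]
  · exact (hτA u rfl).trans hψ.map_root

/-- Pendancy depends only on colour, so the non-pendant vertices inherit a stable colouring and the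
induction applies to them. For pendant `u` and `w`, an automorphism first aligns their anchors, then
`u` is moved around the common anchor. -/
theorem IsStable.exists_colorAut [Finite V] {G : SimpleGraph V} {c : V → C}
    (hG : IsTriangleCactus G) (hc : IsStable G c) {u w : V} (huw : c u = c w) :
    ∃ σ : Equiv.Perm V, IsColorAut G c σ ∧ σ u = w := by
  induction hn : Nat.card V using Nat.strong_induction_on generalizing V with
  | _ n ih =>
  have : Nonempty V := ⟨u⟩
  obtain ⟨x₀, hx₀⟩ := hG.exists_isPendant
  have hlt : Nat.card {x // ¬ IsPendant G x} < n := by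
    rw [← hn]
    exact Finite.card_subtype_lt (x := x₀) (not_not.2 hx₀)
  have step : ∀ s t : {x // ¬ IsPendant G x}, c s = c t →
      ∃ σ : Equiv.Perm V, IsColorAut G c σ ∧ σ s = t := by
    intro s t hst
    obtain ⟨φ, hφ, hφs⟩ := ih _ hlt (hG.comap _)
      (hc.comap_subtype _ fun x y h hx hy => hx (hc.isPendant h.symm hy)) hst rfl
    obtain ⟨σ, hσ, hσφ⟩ := hc.exists_colorAut_extension φ hφ
    exact ⟨σ, hσ, by rw [hσφ, hφs]⟩
  by_cases hu : IsPendant G u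
  swap
  · exact step ⟨u, hu⟩ ⟨w, fun h => hu (hc.isPendant huw.symm h)⟩ huw
  have hw : IsPendant G w := hc.isPendant huw hu
  have transfer : ∀ {u w : V}, c u = c w → ∀ s, ¬ IsPendant G s → G.Adj u s →
      ∃ t, ¬ IsPendant G t ∧ G.Adj w t ∧ c s = c t := by
    intro u w huw s hs hus
    obtain ⟨ψ, hψ⟩ := hc u w huw
    have hcs := hψ.color s (Or.inr hus)
    refine ⟨ψ s, fun h => hs (hc.isPendant hcs h), ?_, hcs.symm⟩
    rw [← hψ.map_root]
    exact hψ.adj u (self_mem_closedNbhd _ _) s (Or.inr hus) hus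
  by_cases hsu : ∃ s, ¬ IsPendant G s ∧ G.Adj u s
  · obtain ⟨s, hs, hus⟩ := hsu
    obtain ⟨t, ht, hwt, hst⟩ := transfer huw s hs hus
    obtain ⟨σ, hσ, hσs⟩ := step ⟨s, hs⟩ ⟨t, ht⟩ hst
    have hσu : G.Adj (σ u) t := by
      have := hσ.1 u s hus
      rwa [show σ s = t from hσs] at this
    have hσup : IsPendant G (σ u) := hc.isPendant (hσ.2 u).symm hu
    obtain ⟨τ, hτ, hτu⟩ := hc.exists_colorAut_of_isPendant ((hσ.2 u).trans huw) hσup fun t' ht' =>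
      ⟨fun h => hσup.eq_of_adj ht ht' hσu h ▸ hwt, fun h => hw.eq_of_adj ht ht' hwt h ▸ hσu⟩
    exact ⟨σ.trans τ, ⟨fun x y h => hτ.1 _ _ (hσ.1 x y h), fun x => (hτ.2 _).trans (hσ.2 x)⟩, hτu⟩
  · push Not at hsu
    refine hc.exists_colorAut_of_isPendant huw hu fun s hs => ⟨fun h => (hsu s hs h).elim, fun h => ?_⟩
    obtain ⟨t, ht, hut, -⟩ := transfer huw.symm s hs h
    exact (hsu t ht hut).elim

end Combinatorics

/-! ### Passing from automorphisms of a disjoint union to isomorphisms -/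

section DisjointUnion

variable {n m : ℕ} {C ι : Type}

/-- The disjoint union of a family of graphs on `Fin n`. -/
def disjointUnion (G : ι → SimpleGraph (Fin n)) : SimpleGraph (ι × Fin n) where
  Adj p q := p.1 = q.1 ∧ (G p.1).Adj p.2 q.2
  symm.symm := by
    rintro ⟨a, i⟩ ⟨b, j⟩ ⟨rfl, h⟩
    exact ⟨rfl, h.symm⟩
  loopless.irrefl := fun _ h => h.2.ne rfl

theorem ReachableAvoiding.of_disjointUnion {G : ι → SimpleGraph (Fin n)} {a : ι} {x i : Fin n}
    {q : ι × Fin n} (h : ReachableAvoiding (disjointUnion G) (a, x) (a, i) q) :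
    q.1 = a ∧ ReachableAvoiding (G a) x i q.2 := by
  induction h with
  | refl => exact ⟨rfl, .refl⟩
  | @tail b c _ hbc ih =>
    obtain ⟨b₁, b₂⟩ := b
    obtain ⟨c₁, c₂⟩ := c
    obtain ⟨rfl, ih⟩ := ih
    obtain ⟨⟨h, hadj⟩, hb, hc⟩ := hbc
    dsimp only at h hadj ih hb hc ⊢
    subst h
    exact ⟨rfl, ih.tail ⟨hadj, fun h => hb (by rw [h]), fun h => hc (by rw [h])⟩⟩

theorem IsTriangleCactus.disjointUnion {G : ι → SimpleGraph (Fin n)}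
    (hG : ∀ a, IsTriangleCactus (G a)) : IsTriangleCactus (disjointUnion G) := by
  refine ⟨?_, ?_⟩
  · rintro ⟨a, x⟩ ⟨b, i⟩ ⟨b', j⟩ ⟨h, hxi⟩ ⟨h', hxj⟩ hij hr
    dsimp only at h hxi h' hxj
    subst h h'
    exact ⟨rfl, (hG a).adj_of_reachable x i j hxi hxj (fun h => hij (by rw [h]))
      hr.of_disjointUnion.2⟩
  · rintro ⟨a, i⟩ ⟨b, j⟩ ⟨b', k⟩ ⟨b'', l⟩ ⟨h, h1⟩ ⟨h', h2⟩ ⟨h'', h3⟩ ⟨-, h4⟩ hik hjl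
    dsimp only at h h' h'' h1 h2 h3 h4
    subst h h' h''
    exact (hG a).no_four_cycle i j k l h1 h2 h3 h4 (fun h => hik (by rw [h]))
      fun h => hjl (by rw [h])

theorem mem_nbhd_one {G : SimpleGraph (Fin n)} {u v : Fin n} :
    u ∈ nbhd G 1 v ↔ u ∈ closedNbhd G v := by
  rw [nbhd, Set.mem_ofPred_eq, Nat.cast_one, SimpleGraph.edist_le_one_iff_adj_or_eq, or_comm,
    SimpleGraph.adj_comm]
  rfl

theorem isStable_disjointUnion {G : ι → SimpleGraph (Fin n)} {c : ι × Fin n → C}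
    (h : ∀ a b i j, c (a, i) = c (b, j) →
      ∃ e : (G a).induce (nbhd (G a) 1 i) ≃g (G b).induce (nbhd (G b) 1 j),
        e ⟨i, mem_nbhd_self _ _ _⟩ = ⟨j, mem_nbhd_self _ _ _⟩ ∧ ∀ u, c (b, e u) = c (a, u)) :
    IsStable (disjointUnion G) c := by
  classical
  rintro ⟨a, i⟩ ⟨b, j⟩ hc
  obtain ⟨e, he, hec⟩ := h a b i j hc
  let ψ : ι × Fin n → ι × Fin n := fun p =>
    (b, if hp : p.2 ∈ nbhd (G a) 1 i then e ⟨p.2, hp⟩ else j)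
  have hψ : ∀ x (hx : x ∈ nbhd (G a) 1 i), ψ (a, x) = (b, (e ⟨x, hx⟩ : Fin n)) := fun x hx => by
    simp [ψ, hx]
  have hN : ∀ p ∈ closedNbhd (disjointUnion G) (a, i), ∃ x ∈ nbhd (G a) 1 i, p = (a, x) := by
    rintro ⟨a', x⟩ (h | ⟨h, hx⟩)
    · exact ⟨i, mem_nbhd_self _ _ _, h⟩
    · dsimp only at h hx
      subst h
      exact ⟨x, mem_nbhd_one.2 (Or.inr hx), rfl⟩
  refine ⟨ψ, ?_, ?_, ?_, ?_⟩
  · rw [hψ i (mem_nbhd_self _ _ _), he]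
  · intro p hp q hq hpq
    obtain ⟨x, hx, rfl⟩ := hN p hp
    obtain ⟨y, hy, rfl⟩ := hN q hq
    rw [hψ x hx, hψ y hy, Prod.mk.injEq] at hpq
    have := e.injective (Subtype.ext hpq.2)
    rw [Subtype.mk.injEq] at this
    rw [this]
  · intro p hp
    obtain ⟨x, hx, rfl⟩ := hN p hp
    rw [hψ x hx]
    exact hec _
  · intro p hp q hq hpq
    obtain ⟨x, hx, rfl⟩ := hN p hp
    obtain ⟨y, hy, rfl⟩ := hN q hq
    rw [hψ x hx, hψ y hy]
    exact ⟨rfl, e.map_rel_iff.2 hpq.2⟩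

/-- Equally coloured vertices of two coloured connected triangle cacti, the colouring being stable,
correspond under an isomorphism of coloured graphs. -/
theorem exists_iso_of_stable [Finite ι] {G : ι → SimpleGraph (Fin n)} {c : ι × Fin n → C}
    (hG : ∀ a, IsTriangleCactus (G a)) (hconn : ∀ a, (G a).Connected)
    (hc : IsStable (disjointUnion G) c) {a b : ι} {i j : Fin n} (hij : c (a, i) = c (b, j)) :
    ∃ σ : Equiv.Perm (Fin n), σ i = j ∧ (∀ x y, (G b).Adj (σ x) (σ y) ↔ (G a).Adj x y) ∧
      ∀ x, c (b, σ x) = c (a, x) := by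
  obtain ⟨τ, hτ, hτi⟩ := hc.exists_colorAut (.disjointUnion hG) hij
  have hb : ∀ x, (τ (a, x)).1 = b := by
    -- Edges of the union stay within one copy, so along a walk to `i` the images stay in copy `b`.
    intro x
    obtain ⟨p⟩ := (hconn a).preconnected x i
    induction p with
    | nil => rw [hτi]
    | @cons u v _ hadj _ ih => exact (hτ.1 (a, u) (a, v) ⟨rfl, hadj⟩).1.trans (ih hij hτi)
  have hb' : ∀ x, τ (a, x) = (b, (τ (a, x)).2) := fun x => Prod.ext (hb x) rfl
  have hinj : Function.Injective fun x => (τ (a, x)).2 := by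
    intro x y hxy
    dsimp only at hxy
    have := τ.injective ((hb' x).trans (hxy ▸ (hb' y).symm))
    exact (Prod.mk.inj this).2
  refine ⟨Equiv.ofBijective _ (Finite.injective_iff_bijective.1 hinj), ?_, ?_, ?_⟩
  · change (τ (a, i)).2 = j
    rw [hτi]
  · intro x y
    change (G b).Adj (τ (a, x)).2 (τ (a, y)).2 ↔ _
    have := hτ.adj_iff (a, x) (a, y)
    rw [hb' x, hb' y] at this
    simpa [SubgraphGNN.disjointUnion] using this
  · intro x
    change c (b, (τ (a, x)).2) = _
    rw [← hb' x, hτ.2]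

theorem eq_relabel {X Y : FeaturedGraph n m} (σ : Equiv.Perm (Fin n))
    (hadj : ∀ x y, Y.graph.Adj (σ x) (σ y) ↔ X.graph.Adj x y)
    (hfeat : ∀ x, Y.feat (σ x) = X.feat x) : Y = X.relabel σ := by
  ext x y
  · obtain ⟨x, rfl⟩ := σ.surjective x
    obtain ⟨y, rfl⟩ := σ.surjective y
    rw [hadj]
    exact (SimpleGraph.map_adj_apply (f := σ.toEmbedding)).symm
  · obtain ⟨x, rfl⟩ := σ.surjective x
    simp [FeaturedGraph.relabel, hfeat]

end DisjointUnion

/-! ### Continuity, parallel composition and the isomorphism test of networks -/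

section Networks

variable {n m : ℕ}

theorem FeaturedGraph.continuous_mk (G : SimpleGraph (Fin n)) :
    Continuous fun x : Fin n → Feat m => (⟨G, x⟩ : FeaturedGraph n m) := by
  let : TopologicalSpace (SimpleGraph (Fin n)) := ⊥
  exact continuous_induced_rng.2 (Continuous.prodMk continuous_const continuous_id)

theorem FeaturedGraph.continuous_of_forall_graph {T : Type*} [TopologicalSpace T]
    {F : FeaturedGraph n m → T}
    (hF : ∀ G : SimpleGraph (Fin n), Continuous fun x : Fin n → Feat m => F ⟨G, x⟩) :
    Continuous F := by
  let : TopologicalSpace (SimpleGraph (Fin n)) := ⊥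
  have : DiscreteTopology (SimpleGraph (Fin n)) := ⟨rfl⟩
  have h : Continuous fun p : SimpleGraph (Fin n) × (Fin n → Feat m) => F ⟨p.1, p.2⟩ :=
    continuous_prod_of_discrete_left.2 hF
  exact h.comp (continuous_induced_dom (f := FeaturedGraph.toPair))

theorem FeaturedGraph.continuous_feat :
    Continuous fun X : FeaturedGraph n m => X.feat :=
  continuous_of_forall_graph fun _ => continuous_id

theorem FeaturedGraph.isCompact_setOf (S : Set (SimpleGraph (Fin n))) (R : ℝ) :
    IsCompact {X : FeaturedGraph n m | X.graph ∈ S ∧ ‖X.feat‖ ≤ R} := by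
  have : {X : FeaturedGraph n m | X.graph ∈ S ∧ ‖X.feat‖ ≤ R} =
      ⋃ G ∈ S, (fun x => (⟨G, x⟩ : FeaturedGraph n m)) '' Metric.closedBall 0 R := by
    ext X
    simp only [Set.mem_ofPred_eq, Set.mem_iUnion, Set.mem_image, mem_closedBall_zero_iff]
    constructor
    · exact fun h => ⟨X.graph, h.1, X.feat, h.2, rfl⟩
    · rintro ⟨G, hG, x, hx, rfl⟩
      exact ⟨hG, hx⟩
  rw [this]
  exact S.toFinite.isCompact_biUnion fun G _ =>
    (isCompact_closedBall 0 R).image (continuous_mk G)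

/-- Application of a map to all the features of a rooted graph. -/
def RootedGraph.mapFeat {d e : ℕ} (p : Feat d → Feat e) (A : RootedGraph d) : RootedGraph e :=
  haveI := A.finite
  ⟨A.V, A.graph, A.root, fun u => p (A.feat u)⟩

theorem IsAdmissible.comp_mapFeat {d e d' : ℕ} {g : RootedGraph e → Feat d'} (hg : IsAdmissible g)
    {p : Feat d → Feat e} (hp : Continuous p) : IsAdmissible fun A => g (A.mapFeat p) where
  eq_of_isomorphic := by
    rintro A B ⟨e, he, hf⟩
    exact hg.eq_of_isomorphic _ _ ⟨e, he, fun u => congrArg p (hf u)⟩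
  continuous := by
    intro V _ G v
    exact (hg.continuous V G v).comp
      (continuous_pi fun u => hp.comp (continuous_apply u))

theorem isAdmissible_const {d e : ℕ} (a : Feat e) : IsAdmissible fun _ : RootedGraph d => a :=
  ⟨fun _ _ _ => rfl, fun _ _ _ _ => continuous_const⟩

variable {k d d₁ d₂ : ℕ}

theorem IsHidden.continuous {h : FeaturedGraph n m → Fin n → Feat d} (hh : IsHidden k d h)
    (i : Fin n) : Continuous fun X => h X i := by
  induction hh generalizing i with
  | embedding f hf => exact hf.comp ((continuous_apply i).comp FeaturedGraph.continuous_feat)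
  | @layer d e d' h hh g hg f hf ih =>
    refine hf.comp ((ih i).prodMk (FeaturedGraph.continuous_of_forall_graph fun G => ?_))
    have hx : Continuous fun (x : Fin n → Feat m) (u : nbhd G k i) => h ⟨G, x⟩ u :=
      continuous_pi fun u => (ih u).comp (FeaturedGraph.continuous_mk G)
    exact (hg.continuous (nbhd G k i) (G.induce (nbhd G k i)) ⟨i, mem_nbhd_self G k i⟩).comp hx

theorem IsHidden.comp {h : FeaturedGraph n m → Fin n → Feat d} (hh : IsHidden k d h)
    {r : Feat d → Feat d₁} (hr : Continuous r) : IsHidden k d₁ fun X i => r (h X i) :=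
  hh.layer (fun _ => (0 : Feat 0)) (isAdmissible_const 0) (fun a => r a.1) (hr.comp continuous_fst)

/-- Euclidean spaces of dimensions `d` and `e` combine to one of dimension `d + e`. -/
noncomputable def featProd (d e : ℕ) : Feat (d + e) ≃L[ℝ] Feat d × Feat e :=
  ContinuousLinearEquiv.ofFinrankEq (by simp)

/-- Two networks run in parallel. -/
theorem IsHidden.prod {h₁ : FeaturedGraph n m → Fin n → Feat d₁} (hh₁ : IsHidden k d₁ h₁)
    {h₂ : FeaturedGraph n m → Fin n → Feat d₂} (hh₂ : IsHidden k d₂ h₂) :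
    IsHidden k (d₁ + d₂) fun X i => (featProd d₁ d₂).symm (h₁ X i, h₂ X i) := by
  have hfst : ∀ d e, Continuous fun a => (featProd d e a).1 :=
    fun d e => continuous_fst.comp (featProd d e).continuous
  have hsnd : ∀ d e, Continuous fun a => (featProd d e a).2 :=
    fun d e => continuous_snd.comp (featProd d e).continuous
  -- The two networks run one after the other on the combined feature, each layer carrying the idle
  -- component along unchanged.
  induction hh₁ with
  | @embedding d₁ f₁ hf₁ =>
    induction hh₂ with
    | @embedding d₂ f₂ hf₂ =>
      exact .embedding (fun x => (featProd d₁ d₂).symm (f₁ x, f₂ x))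
        ((featProd d₁ d₂).symm.continuous.comp (hf₁.prodMk hf₂))
    | @layer d e d' h hh g hg f hf ih =>
      have := ih.layer _ (hg.comp_mapFeat (hsnd d₁ d))
        (fun a => (featProd d₁ d').symm ((featProd d₁ d a.1).1, f ((featProd d₁ d a.1).2, a.2)))
        ((featProd d₁ d').symm.continuous.comp (((hfst d₁ d).comp continuous_fst).prodMk
          (hf.comp (((hsnd d₁ d).comp continuous_fst).prodMk continuous_snd))))
      simpa [RootedGraph.mapFeat, hopSubgraph] using this
  | @layer d e d' h hh g hg f hf ih =>
    have := ih.layer _ (hg.comp_mapFeat (hfst d d₂))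
      (fun a => (featProd d' d₂).symm (f ((featProd d d₂ a.1).1, a.2), (featProd d d₂ a.1).2))
      ((featProd d' d₂).symm.continuous.comp
        ((hf.comp (((hfst d d₂).comp continuous_fst).prodMk continuous_snd)).prodMk
          ((hsnd d d₂).comp continuous_fst)))
    simpa [RootedGraph.mapFeat, hopSubgraph] using this

theorem IsHidden.comp₂ {h₁ : FeaturedGraph n m → Fin n → Feat d₁} (hh₁ : IsHidden k d₁ h₁)
    {h₂ : FeaturedGraph n m → Fin n → Feat d₂} (hh₂ : IsHidden k d₂ h₂)
    {r : Feat d₁ × Feat d₂ → Feat d} (hr : Continuous r) :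
    IsHidden k d fun X i => r (h₁ X i, h₂ X i) := by
  simpa using (hh₁.prod hh₂).comp (hr.comp (featProd d₁ d₂).continuous)

/-- The isomorphisms of rooted graphs, regardless of the features. -/
def RootedGraph.Iso (A B : RootedGraph d) : Type := {e : A.graph ≃g B.graph // e A.root = B.root}

instance RootedGraph.finite_iso (A B : RootedGraph d) : Finite (A.Iso B) :=
  have := A.finite
  have := B.finite
  Finite.of_injective (fun (e : A.Iso B) (u : A.V) => e.1 u)
    fun _ _ h => Subtype.ext (DFunLike.coe_injective h)

/-- A function which vanishes exactly on the rooted graphs isomorphic to `A`. -/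
noncomputable def isoDefect (A B : RootedGraph d) : ℝ :=
  ∏ᶠ e : A.Iso B, ∑ᶠ u : A.V, ‖B.feat (e.1 u) - A.feat u‖

/-- The product vanishes when some isomorphism matches every feature; with no isomorphism at all it
is the empty product 1. -/
theorem isoDefect_eq_zero_iff {A B : RootedGraph d} : isoDefect A B = 0 ↔ A.Isomorphic B := by
  classical
  have := A.finite
  let := Fintype.ofFinite A.V
  let := Fintype.ofFinite (A.Iso B)
  rw [isoDefect, finprod_eq_prod_of_fintype, Finset.prod_eq_zero_iff]
  simp only [finsum_eq_sum_of_fintype, Finset.mem_univ, true_and]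
  constructor
  · rintro ⟨e, he⟩
    rw [Finset.sum_eq_zero_iff_of_nonneg fun _ _ => norm_nonneg _] at he
    exact ⟨e.1, e.2, fun u => sub_eq_zero.1 (norm_eq_zero.1 (he u (Finset.mem_univ u)))⟩
  · rintro ⟨e, he, hf⟩
    exact ⟨⟨e, he⟩, Finset.sum_eq_zero fun u _ => by simp [hf]⟩

/-- Composing with an isomorphism only reindexes the factors. The index set does not depend on the
features, whence continuity. -/
theorem isAdmissible_isoDefect (A : RootedGraph d) :
    IsAdmissible fun B => (WithLp.toLp 2 fun _ => isoDefect A B : Feat 1) where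
  eq_of_isomorphic := by
    rintro B B' ⟨e, he, hf⟩
    have : isoDefect A B = isoDefect A B' := by
      let E : A.Iso B ≃ A.Iso B' :=
        { toFun := fun f => ⟨f.1.trans e, by simp [f.2, he]⟩
          invFun := fun f => ⟨f.1.trans e.symm, by simp [f.2, ← he]⟩
          left_inv := fun f => Subtype.ext (RelIso.ext fun x => by simp)
          right_inv := fun f => Subtype.ext (RelIso.ext fun x => by simp) }
      refine finprod_eq_of_bijective E E.bijective fun f => ?_
      refine finsum_congr fun u => ?_
      change _ = ‖B'.feat (e (f.1 u)) - A.feat u‖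
      rw [hf]
    simp only [this]
  continuous := by
    intro V _ G v
    have := A.finite
    let := Fintype.ofFinite A.V
    have key : Continuous fun x : V → Feat d => isoDefect A ⟨V, G, v, x⟩ := by
      let I := {e : A.graph ≃g G // e A.root = v}
      have : Finite I := RootedGraph.finite_iso A ⟨V, G, v, fun _ => 0⟩
      let := Fintype.ofFinite I
      have : ∀ x : V → Feat d, isoDefect A ⟨V, G, v, x⟩ =
          ∏ e : I, ∑ u : A.V, ‖x (e.1 u) - A.feat u‖ := by
        intro x
        rw [← finprod_eq_prod_of_fintype]
        simp only [← finsum_eq_sum_of_fintype]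
        rfl
      simp only [this]
      exact continuous_finsetProd _ fun e _ => continuous_finsetSum _ fun u _ =>
        ((continuous_apply (e.1 u)).sub continuous_const).norm
    exact (PiLp.continuous_toLp 2 _).comp (continuous_pi fun _ => key)

end Networks

/-! ### Indistinguishable vertices and uniform approximation on compact sets -/

section Approximation

variable {n m : ℕ}

/-- No network with scalar output distinguishes the vertex `i` of `X` from the vertex `j` of `Y`. -/
def Indistinguishable (X : FeaturedGraph n m) (i : Fin n) (Y : FeaturedGraph n m) (j : Fin n) :
    Prop :=
  ∀ h : FeaturedGraph n m → Fin n → Feat 1, IsHidden 1 1 h → h X i = h Y j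

/-- There are finitely many pairs of vertices, so finitely many scalar networks in parallel detect
everything that the infinite family of networks detects on `X` and `Y`. -/
theorem exists_isHidden_separating (X Y : FeaturedGraph n m) :
    ∃ (d : ℕ) (h : FeaturedGraph n m → Fin n → Feat d), IsHidden 1 d h ∧
      ∀ i j, h X i = h Y j → Indistinguishable X i Y j := by
  classical
  suffices ∀ s : Finset (Fin n × Fin n), ∃ (d : ℕ) (h : FeaturedGraph n m → Fin n → Feat d),
      IsHidden 1 d h ∧ ∀ p ∈ s, h X p.1 = h Y p.2 → Indistinguishable X p.1 Y p.2 by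
    obtain ⟨d, h, hh, hs⟩ := this Finset.univ
    exact ⟨d, h, hh, fun i j => hs (i, j) (Finset.mem_univ _)⟩
  intro s
  induction s using Finset.induction_on with
  | empty => exact ⟨0, _, .embedding (fun _ => 0) continuous_const, by simp⟩
  | insert p s _ ih =>
    obtain ⟨d, h, hh, hs⟩ := ih
    by_cases hp : Indistinguishable X p.1 Y p.2
    · refine ⟨d, h, hh, fun q hq hq' => ?_⟩
      rcases Finset.mem_insert.1 hq with rfl | hq
      · exact hp
      · exact hs q hq hq'
    · simp only [Indistinguishable, not_forall] at hp
      obtain ⟨h', hh', hne⟩ := hp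
      refine ⟨_, _, hh.prod hh', fun q hq hq' => ?_⟩
      have heq := (featProd d 1).symm.injective hq'
      rw [Prod.mk.injEq] at heq
      rcases Finset.mem_insert.1 hq with rfl | hq
      · exact absurd heq.2 hne
      · exact hs q hq heq.1

/-- To a separating network add one layer testing against the neighbourhood of `i` in `X`. It
vanishes at `i`, hence also at `j`. -/
theorem Indistinguishable.exists_iso {X Y : FeaturedGraph n m} {i j : Fin n}
    (hij : Indistinguishable X i Y j) :
    ∃ e : X.graph.induce (nbhd X.graph 1 i) ≃g Y.graph.induce (nbhd Y.graph 1 j),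
      e ⟨i, mem_nbhd_self _ _ _⟩ = ⟨j, mem_nbhd_self _ _ _⟩ ∧
        ∀ u : nbhd X.graph 1 i, Indistinguishable X u Y (e u) := by
  obtain ⟨d, h, hh, hsep⟩ := exists_isHidden_separating X Y
  have key := hij _ (hh.layer _ (isAdmissible_isoDefect (hopSubgraph X.graph (h X) 1 i))
    (fun a => a.2) continuous_snd)
  have key' := congrArg (fun v : Feat 1 => v 0) key
  dsimp only at key'
  rw [isoDefect_eq_zero_iff.2 ⟨.refl, rfl, fun _ => rfl⟩] at key'
  obtain ⟨e, he, hf⟩ := isoDefect_eq_zero_iff.1 key'.symm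
  exact ⟨e, he, fun u => hsep _ _ (hf u).symm⟩

theorem Indistinguishable.feat_eq {X Y : FeaturedGraph n m} {i j : Fin n}
    (hij : Indistinguishable X i Y j) : X.feat i = Y.feat j := by
  ext k
  have := hij _ (.embedding (fun x : Feat m => (WithLp.toLp 2 fun _ => x k : Feat 1))
    ((PiLp.continuous_toLp 2 _).comp (continuous_pi fun _ => by fun_prop)))
  exact congrArg (fun v : Feat 1 => v 0) this

theorem Indistinguishable.exists_relabel {X Y : FeaturedGraph n m} {i j : Fin n}
    (hij : Indistinguishable X i Y j)
    (hX : X.graph.Connected ∧ NoCycleLongerThan X.graph 3)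
    (hY : Y.graph.Connected ∧ NoCycleLongerThan Y.graph 3) :
    ∃ σ : Equiv.Perm (Fin n), Y = X.relabel σ ∧ σ i = j := by
  let Z : Bool → FeaturedGraph n m := fun b => cond b Y X
  have hZ : ∀ b, (Z b).graph.Connected ∧ NoCycleLongerThan (Z b).graph 3 := by
    rintro (_ | _)
    · exact hX
    · exact hY
  let c : Bool × Fin n → {h : FeaturedGraph n m → Fin n → Feat 1 // IsHidden 1 1 h} → Feat 1 :=
    fun p h => h.1 (Z p.1) p.2
  have hc : ∀ {a b x y}, c (a, x) = c (b, y) ↔ Indistinguishable (Z a) x (Z b) y := fun {_ _ _ _} =>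
    ⟨fun h g hg => congrFun h ⟨g, hg⟩, fun h => funext fun g => h g.1 g.2⟩
  have hst : IsStable (disjointUnion fun b => (Z b).graph) c := by
    refine isStable_disjointUnion fun a b x y hxy => ?_
    obtain ⟨e, he, hu⟩ := (hc.1 hxy).exists_iso
    exact ⟨e, he, fun u => (hc.2 (hu u)).symm⟩
  obtain ⟨σ, hσ, hadj, hcol⟩ := exists_iso_of_stable (a := false) (b := true)
    (fun b => isTriangleCactus_of_cycle_length_le (hZ b).2) (fun b => (hZ b).1) hst (hc.2 hij)
  exact ⟨σ, eq_relabel σ hadj fun x => (hc.1 (hcol x)).feat_eq, hσ⟩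

/-- The Stone-Weierstrass theorem for subalgebras which need not separate points. -/
theorem exists_mem_subalgebra_near_of_separates {T : Type*} [TopologicalSpace T] [CompactSpace T]
    (A : Subalgebra ℝ C(T, ℝ)) (F : C(T, ℝ))
    (hF : ∀ x y, (∀ f ∈ A, f x = f y) → F x = F y) {ε : ℝ} (hε : 0 < ε) :
    ∃ g ∈ A, ∀ x, |g x - F x| < ε := by
  -- On the quotient by this relation, which is still compact, `A` descends to a subalgebra that
  -- separates points.
  let S : Setoid T :=
    ⟨fun x y => ∀ f ∈ A, f x = f y, fun _ _ _ => rfl, fun h f hf => (h f hf).symm,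
      fun h h' f hf => (h f hf).trans (h' f hf)⟩
  let q : C(T, Quotient S) := ⟨Quotient.mk S, continuous_quotient_mk'⟩
  let B : Subalgebra ℝ C(Quotient S, ℝ) := A.comap (ContinuousMap.compRightAlgHom ℝ ℝ q)
  have hB : B.SeparatesPoints := by
    intro z z' hzz
    induction z, z' using Quotient.inductionOn₂ with
    | _ x y =>
    have : ¬ ∀ f ∈ A, f x = f y := fun h => hzz (Quotient.sound h)
    push Not at this
    obtain ⟨f, hf, hne⟩ := this
    let f' : C(Quotient S, ℝ) :=
      ⟨Quotient.lift f fun a b hab => hab f hf, f.continuous.quotient_lift _⟩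
    refine ⟨f', ⟨f', ?_, rfl⟩, hne⟩
    change f'.comp q ∈ A
    convert hf
    ext; rfl
  let F' : C(Quotient S, ℝ) := ⟨Quotient.lift F hF, F.continuous.quotient_lift _⟩
  obtain ⟨⟨g, hg⟩, hgF⟩ :=
    ContinuousMap.exists_mem_subalgebra_near_continuousMap_of_separatesPoints B hB F' ε hε
  refine ⟨g.comp q, hg, fun x => ?_⟩
  exact ((g - F').norm_coe_le_norm (q x)).trans_lt hgF

/-- The functions on a set of featured graphs with a distinguished vertex that the scalar networks
compute. -/
def hiddenSubalgebra (K : Set (FeaturedGraph n m)) : Subalgebra ℝ C(K × Fin n, ℝ) where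
  carrier := {f | ∃ h : FeaturedGraph n m → Fin n → Feat 1, IsHidden 1 1 h ∧
    ∀ t, f t = h t.1 t.2 0}
  mul_mem' := by
    rintro f g ⟨h, hh, hf⟩ ⟨h', hh', hg⟩
    refine ⟨_, hh.comp₂ hh' (r := fun a => (WithLp.toLp 2 fun _ => a.1 0 * a.2 0 : Feat 1)) ?_,
      fun t => by simp [hf, hg]⟩
    exact (PiLp.continuous_toLp 2 _).comp (continuous_pi fun _ => by fun_prop)
  add_mem' := by
    rintro f g ⟨h, hh, hf⟩ ⟨h', hh', hg⟩
    refine ⟨_, hh.comp₂ hh' (r := fun a => (WithLp.toLp 2 fun _ => a.1 0 + a.2 0 : Feat 1)) ?_,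
      fun t => by simp [hf, hg]⟩
    exact (PiLp.continuous_toLp 2 _).comp (continuous_pi fun _ => by fun_prop)
  algebraMap_mem' := fun a =>
    ⟨_, .embedding (fun _ => (WithLp.toLp 2 fun _ => a : Feat 1)) continuous_const, fun t => by simp⟩

/-- This serves both output levels: an invariant function is the case of an `F` that does not depend
on the vertex. -/
theorem exists_isHidden_near {K : Set (FeaturedGraph n m)} (hK : IsCompact K)
    (hKG : ∀ X ∈ K, X.graph.Connected ∧ NoCycleLongerThan X.graph 3)
    {F : FeaturedGraph n m → Fin n → ℝ} (hF : ∀ i, Continuous fun X => F X i)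
    (hinv : ∀ (σ : Equiv.Perm (Fin n)) X i, F (X.relabel σ) i = F X (σ.symm i))
    {δ : ℝ} (hδ : 0 < δ) :
    ∃ h : FeaturedGraph n m → Fin n → Feat 1, IsHidden 1 1 h ∧
      ∀ X ∈ K, ∀ i, |h X i 0 - F X i| < δ := by
  have : CompactSpace K := isCompact_iff_compactSpace.1 hK
  let F' : C(K × Fin n, ℝ) := ⟨fun t => F t.1 t.2, continuous_prod_of_discrete_right.2 fun i =>
    (hF i).comp continuous_subtype_val⟩
  obtain ⟨g, ⟨h, hh, hgh⟩, hg⟩ := exists_mem_subalgebra_near_of_separates (hiddenSubalgebra K) F' (by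
    rintro ⟨X, i⟩ ⟨Y, j⟩ hXY
    have hij : Indistinguishable (X : FeaturedGraph n m) i Y j := by
      intro h hh
      have := hXY ⟨fun t => h t.1 t.2 0, continuous_prod_of_discrete_right.2 fun i => by
        have := (hh.continuous i).comp (continuous_subtype_val (p := (· ∈ K)))
        exact (PiLp.continuous_apply 2 _ 0).comp this⟩ ⟨h, hh, fun _ => rfl⟩
      ext k
      rw [Subsingleton.elim k 0]
      exact this
    obtain ⟨σ, hY, hσ⟩ := hij.exists_relabel (hKG X X.2) (hKG Y Y.2)
    change F X i = F Y j
    rw [hY, hinv, ← hσ, Equiv.symm_apply_apply]) hδ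
  refine ⟨h, hh, fun X hX i => ?_⟩
  have := hg (⟨X, hX⟩, i)
  rwa [hgh] at this

/-- The sets of features of norm above N decrease to the empty set, so their measure tends to 0. -/
theorem exists_isCompact_measure_compl_lt (P : Measure (FeaturedGraph n m)) [IsProbabilityMeasure P]
    {S : Set (SimpleGraph (Fin n))} (hP : ∀ᵐ X ∂P, X.graph ∈ S) {ε : ℝ} (hε : 0 < ε) :
    ∃ K : Set (FeaturedGraph n m), IsCompact K ∧ (∀ X ∈ K, X.graph ∈ S) ∧
      P Kᶜ < ENNReal.ofReal ε := by
  have hlim : Filter.Tendsto (fun N : ℕ => P {X | (N : ℝ) < ‖X.feat‖}) Filter.atTop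
      (nhds (P (⋂ N : ℕ, {X | (N : ℝ) < ‖X.feat‖}))) := by
    refine tendsto_measure_iInter_atTop (fun N => ?_) (fun N M hNM X hX => ?_)
      ⟨0, measure_ne_top _ _⟩
    · exact (isOpen_lt continuous_const
        FeaturedGraph.continuous_feat.norm).measurableSet.nullMeasurableSet
    · exact lt_of_le_of_lt (Nat.cast_le.2 hNM) (show (M : ℝ) < ‖X.feat‖ from hX)
  have hempty : (⋂ N : ℕ, {X : FeaturedGraph n m | (N : ℝ) < ‖X.feat‖}) = ∅ := by
    refine Set.eq_empty_of_forall_notMem fun X hX => ?_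
    obtain ⟨N, hN⟩ := exists_nat_ge ‖X.feat‖
    exact not_lt.2 hN (Set.mem_iInter.1 hX N)
  rw [hempty, measure_empty] at hlim
  obtain ⟨N, hN⟩ := (hlim.eventually_lt_const (ENNReal.ofReal_pos.2 hε)).exists
  refine ⟨_, FeaturedGraph.isCompact_setOf S N, fun X hX => hX.1, ?_⟩
  refine lt_of_le_of_lt (measure_mono_ae ?_) hN
  filter_upwards [hP] with X hX hXK
  by_contra h
  exact hXK ⟨hX, not_lt.1 h⟩

end Approximation

end SubgraphGNN

/-! ### Assembling both output levels -/

theorem mainTheorem3 (n m : ℕ) (P : Measure (SubgraphGNN.FeaturedGraph n m))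
    [IsProbabilityMeasure P]
    (hP : ∀ᵐ X ∂P, X.graph.Connected ∧ SubgraphGNN.NoCycleLongerThan X.graph 3) :
    (∀ (a : SubgraphGNN.Aggregator) (ε δ : ℝ), 0 < ε → 0 < δ →
      ∀ Φ : SubgraphGNN.FeaturedGraph n m → ℝ, Continuous Φ → SubgraphGNN.PermInvariant Φ →
        ∃ F ∈ SubgraphGNN.graphGNN a n m 1,
          P {X | |F X - Φ X| > δ} < ENNReal.ofReal ε) ∧
    (∀ ε δ : ℝ, 0 < ε → 0 < δ →
      ∀ Φ : SubgraphGNN.FeaturedGraph n m → EuclideanSpace ℝ (Fin n),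
        Continuous Φ → SubgraphGNN.PermEquivariant Φ →
          ∃ F ∈ SubgraphGNN.vertexGNN n m 1,
            P {X | ‖F X - Φ X‖ > δ} < ENNReal.ofReal ε) := by
  refine ⟨fun a ε δ hε hδ Φ hΦ hinv => ?_, fun ε δ hε hδ Φ hΦ hinv => ?_⟩
  · obtain ⟨K, hK, hKG, hPK⟩ := SubgraphGNN.exists_isCompact_measure_compl_lt P
      (S := {G | G.Connected ∧ SubgraphGNN.NoCycleLongerThan G 3}) hP hε
    -- Every single vertex approximates `Φ X`, so the mean and the maximum do too, and the sum does
    -- after division by `n`.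
    obtain ⟨h, hh, hhΦ⟩ := SubgraphGNN.exists_isHidden_near hK hKG (F := fun X _ => Φ X)
      (fun _ => hΦ) (fun σ X _ => hinv σ X) hδ
    suffices ∃ r : SubgraphGNN.Feat 1 → ℝ, Continuous r ∧
        ∀ X ∈ K, |r (a.aggr (h X)) - Φ X| ≤ δ by
      obtain ⟨r, hr, hrΦ⟩ := this
      refine ⟨_, ⟨1, h, r, hh, hr, rfl⟩, (measure_mono fun X hX hXK => ?_).trans_lt hPK⟩
      exact absurd (hrΦ X hXK) (not_le.2 hX)
    have hmean : ∀ X ∈ K, |(n : ℝ)⁻¹ * ∑ i, h X i 0 - Φ X| ≤ δ := by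
      intro X hX
      obtain ⟨i₀⟩ := (hKG X hX).1.nonempty
      have hn : (0 : ℝ) < n := Nat.cast_pos.2 i₀.pos
      have hsum : (n : ℝ)⁻¹ * ∑ i, h X i 0 - Φ X = (n : ℝ)⁻¹ * ∑ i, (h X i 0 - Φ X) := by
        rw [Finset.sum_sub_distrib, mul_sub, Finset.sum_const, Finset.card_univ, Fintype.card_fin,
          nsmul_eq_mul, inv_mul_cancel_left₀ hn.ne']
      rw [hsum, abs_mul, abs_of_pos (inv_pos.2 hn), inv_mul_le_iff₀ hn]
      refine (Finset.abs_sum_le_sum_abs _ _).trans ?_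
      refine (Finset.sum_le_card_nsmul _ _ δ fun i _ => (hhΦ X hX i).le).trans ?_
      simp
    cases a with
    | sum =>
      refine ⟨fun y => (n : ℝ)⁻¹ * y 0, by fun_prop, fun X hX => ?_⟩
      simpa [SubgraphGNN.Aggregator.aggr] using hmean X hX
    | mean =>
      refine ⟨fun y => y 0, by fun_prop, fun X hX => ?_⟩
      simpa [SubgraphGNN.Aggregator.aggr] using hmean X hX
    | max =>
      refine ⟨fun y => y 0, by fun_prop, fun X hX => ?_⟩
      have := (hKG X hX).1.nonempty
      obtain ⟨i, hi⟩ := exists_eq_ciSup_of_finite (f := fun i => h X i 0)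
      change |(⨆ i, h X i 0) - Φ X| ≤ δ
      rw [← hi]
      exact (hhΦ X hX i).le
  · obtain ⟨K, hK, hKG, hPK⟩ := SubgraphGNN.exists_isCompact_measure_compl_lt P
      (S := {G | G.Connected ∧ SubgraphGNN.NoCycleLongerThan G 3}) hP hε
    -- Coordinate error δ / (n + 1) suffices since n (δ / (n + 1))² ≤ δ²; the + 1 covers `n = 0`.
    have hn : (0 : ℝ) < n + 1 := by positivity
    obtain ⟨h, hh, hhΦ⟩ := SubgraphGNN.exists_isHidden_near hK hKG (F := fun X i => Φ X i)
      (fun i => (PiLp.continuous_apply 2 _ i).comp hΦ) hinv (div_pos hδ hn)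
    refine ⟨_, ⟨1, h, fun y => y 0, hh, by fun_prop, rfl⟩,
      (measure_mono fun X hX hXK => ?_).trans_lt hPK⟩
    refine not_le.2 (show δ < ‖WithLp.toLp 2 (fun i => h X i 0) - Φ X‖ from hX) ?_
    rw [← abs_of_pos hδ, ← abs_of_nonneg (norm_nonneg _), ← sq_le_sq, EuclideanSpace.real_norm_sq_eq]
    have hle : ∀ i ∈ Finset.univ, ((WithLp.toLp 2 (fun i => h X i 0) - Φ X :
        EuclideanSpace ℝ (Fin n)) i) ^ 2 ≤ (δ / (n + 1)) ^ 2 := fun i _ =>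
      sq_le_sq.2 ((hhΦ X hXK i).le.trans (le_abs_self _))
    refine (Finset.sum_le_card_nsmul _ _ _ hle).trans ?_
    rw [Finset.card_univ, Fintype.card_fin, nsmul_eq_mul, div_pow, mul_div_assoc',
      div_le_iff₀ (by positivity), mul_comm]
    gcongr
    nlinarith [(Nat.cast_nonneg n : (0 : ℝ) ≤ n)]
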